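/- Let $n\ge 2$ and let $\alpha>19$ be a real number. In the max-distance network creation game with agents $1,\dots,n$ and edge price $\alpha$, each agent $v$ chooses a set $s_v$ of other agents; a strategy profile $s=(s_1,\dots,s_n)$ determines the undirected graph $G_s$ on $\{1,\dots,n\}$ in which distinct $u,v$ are adjacent if and only if $u\in s_v$ or $v\in s_u$. The cost of agent $v$ is $$c_s(v)=\alpha\,|s_v|+\max_{u} d_{G_s}(u,v),$$ where $d_{G_s}$ is the graph distance, equal to $+\infty$ between different connected components, and the social cost is $\mathrm{Cost}(s)=\sum_{v} c_s(v)$. A profile $s$ is a (pure) Nash equilibrium if $c_s(v)\le c_{s'}(v)$ for every agent $v$ and every profile $s'$ that differs from $s$ at most in the strategy of $v$. Then Nash equilibria exist, the optimal social cost $\min_s \mathrm{Cost}(s)$ (over all strategy profiles) is positive and finite, and the price of anarchy $$\mathrm{PoA}=\frac{\max\{\mathrm{Cost}(s) : s \text{ a Nash equilibrium}\}}{\min_{s}\mathrm{Cost}(s)}$$ is less than $3$. -/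

import Mathlib

open scoped NNReal ENNReal

namespace NetworkCreation

/-- A (pure) strategy profile: every agent `v` chooses a finite set `s v` of agents other than `v`,
the agents to which `v` builds (and pays for) an edge. -/
abbrev Profile (V : Type*) : Type _ := (v : V) → {t : Finset V // v ∉ t}

variable {V : Type*}

/-- The undirected graph created by a strategy profile. -/
def graph (s : Profile V) : SimpleGraph V where
  Adj u v := u ∈ (s v).1 ∨ v ∈ (s u).1
  symm := ⟨fun _ _ h => h.symm⟩
  loopless := ⟨fun v h => h.elim (s v).2 (s v).2⟩

/-- The cost of agent `v`: `α` times the number of edges it builds, plus its maximum distance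
(in `ℕ∞`, with `⊤` between different components) to the agents of the network. -/
noncomputable def agentCost (α : ℝ≥0) (s : Profile V) (v : V) : ℝ≥0∞ :=
  (α : ℝ≥0∞) * ((s v).1.card : ℝ≥0∞) + ((⨆ u, (graph s).edist v u : ℕ∞) : ℝ≥0∞)

/-- The social cost: the sum of the costs of all agents. -/
noncomputable def socialCost [Fintype V] (α : ℝ≥0) (s : Profile V) : ℝ≥0∞ :=
  ∑ v, agentCost α s v

/-- `s` is a pure Nash equilibrium: no agent can lower its cost by changing only its own
strategy. -/
def IsNash (α : ℝ≥0) (s : Profile V) : Prop :=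
  ∀ v : V, ∀ s' : Profile V, (∀ u, u ≠ v → s' u = s u) → agentCost α s v ≤ agentCost α s' v

/-- The social cost of a worst Nash equilibrium. There are finitely many profiles, so that
the supremum is a maximum as soon as an equilibrium exists. -/
noncomputable def worstNashCost (V : Type*) [Fintype V] (α : ℝ≥0) : ℝ≥0∞ :=
  ⨆ s ∈ {s : Profile V | IsNash α s}, socialCost α s

/-- The optimal social cost over all strategy profiles (a minimum, since there are finitely many
of them, and at least one). -/
noncomputable def optimalCost (V : Type*) [Fintype V] (α : ℝ≥0) : ℝ≥0∞ :=
  ⨅ s : Profile V, socialCost α s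

/-- The price of anarchy. -/
noncomputable def priceOfAnarchy (V : Type*) [Fintype V] (α : ℝ≥0) : ℝ≥0∞ :=
  worstNashCost V α / optimalCost V α

end NetworkCreation

/-!
Fix a Nash equilibrium with `α > 15`. Its graph `G` is connected; choose a vertex `r` of minimal
eccentricity and a breadth-first search tree rooted at `r`. An agent that pays for an edge outside
the tree is at distance at least `α` from `r`. Near the start of its climb to `r` along the tree,
the lower of two consecutive agents never pays for the edge between them: it would gain by dropping
this edge and another redundant one and buying an edge to `r` instead. For the same reason the
climbs of different edges outside the tree are disjoint near their starts.

The vertices on the fundamental cycles, apart from `r`, form the core. If two consecutive vertices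
of a climb have degree two in the core, the next agent gains by swapping its edge to the upper one
for an edge past the lower one, unless its eccentricity is smaller than that of the upper one. As
eccentricities on the climb lie between `ecc G r` and `ecc G r + 2`, this cannot occur three times
in a row, so a branching occurs among any four consecutive vertices. Two branchings for each edge
outside the tree contradict the count of the edges in the core. Hence `G` is a tree.

In a tree, the farthest vertex from the centre `r` has eccentricity at least `2 * ecc G r - 1`, and
buying an edge to `r` shows that no eccentricity exceeds `α + ecc G r + 1`. Therefore
`ecc G r ≤ α + 2`, all eccentricities are at most `2 * α + 3`, and the social cost on `m + 1` agents
is at most `3 * α * m + 3 * m + 2`. Every profile costs at least `α * m + (m + 1)`. Stars are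
equilibria.
-/

namespace NetworkCreation

section Distance

variable {V : Type*} {G : SimpleGraph V} {v p z r : V} {k l : ℕ}

theorem edist_le_of_edist_le (hp : G.edist v p ≤ k) (hz : G.edist p z ≤ l) :
    G.edist v z ≤ (k + l : ℕ) := by
  push_cast
  exact SimpleGraph.edist_triangle.trans (add_le_add hp hz)

theorem edist_le_of_adj (h : G.Adj p z) (hp : G.edist v p ≤ k) (hkl : k + 1 ≤ l) :
    G.edist v z ≤ l := by
  have hz : G.edist p z ≤ (1 : ℕ) := by simp [SimpleGraph.edist_eq_one_iff_adj.2 h]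
  exact (edist_le_of_edist_le hp hz).trans (by exact_mod_cast hkl)

theorem dist_add_dist_le_of_boundary (hG : G.Connected) {H : Set V} (hv : v ∈ H) (hz : z ∉ H)
    (hH : ∀ p q, p ∈ H → q ∉ H → G.Adj p q → q = r) : G.dist v r + G.dist r z ≤ G.dist v z := by
  classical
  obtain ⟨W, hW⟩ := hG.exists_walk_length_eq_dist v z
  obtain ⟨e, he, hfst, hsnd⟩ := W.exists_boundary_dart H hv hz
  have hr : r ∈ W.support := hH _ _ hfst hsnd e.adj ▸ W.dart_snd_mem_support_of_mem_darts he
  rw [← hW, ← W.take_spec hr, SimpleGraph.Walk.length_append]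
  exact add_le_add (SimpleGraph.dist_le _) (SimpleGraph.dist_le _)

/-- The eccentricity of a vertex as a natural number, with value `0` where `SimpleGraph.eccent` is
infinite. -/
noncomputable def ecc (G : SimpleGraph V) (v : V) : ℕ := (G.eccent v).toNat

variable [Finite V]

theorem coe_ecc (hG : G.Connected) (v : V) : (ecc G v : ℕ∞) = G.eccent v := by
  have := hG.nonempty
  obtain ⟨z, hz⟩ := G.exists_edist_eq_eccent_of_finite v
  exact ENat.natCast_toNat (hz ▸ SimpleGraph.edist_ne_top_iff_reachable.2 (hG v z))

theorem edist_le_ecc (hG : G.Connected) (v z : V) : G.edist v z ≤ ecc G v :=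
  coe_ecc hG v ▸ SimpleGraph.edist_le_eccent

theorem dist_le_ecc (hG : G.Connected) (v z : V) : G.dist v z ≤ ecc G v := by
  exact_mod_cast (hG v z).coe_dist_eq_edist ▸ edist_le_ecc hG v z

theorem exists_dist_eq_ecc (hG : G.Connected) (v : V) : ∃ z, G.dist v z = ecc G v := by
  have := hG.nonempty
  obtain ⟨z, hz⟩ := G.exists_edist_eq_eccent_of_finite v
  refine ⟨z, ?_⟩
  exact_mod_cast ((hG v z).coe_dist_eq_edist.trans hz).trans (coe_ecc hG v).symm

theorem one_le_ecc [Nontrivial V] (hG : G.Connected) (v : V) : 1 ≤ ecc G v := by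
  obtain ⟨z, hz⟩ := exists_ne v
  exact (hG.pos_dist_of_ne hz.symm).trans_le (dist_le_ecc hG v z)

theorem ecc_le_ecc_add_dist (hG : G.Connected) (v w : V) : ecc G w ≤ ecc G v + G.dist v w := by
  obtain ⟨z, hz⟩ := exists_dist_eq_ecc hG w
  have := hG.dist_triangle (u := w) (v := v) (w := z)
  have := dist_le_ecc hG v z
  rw [SimpleGraph.dist_comm (v := w)]
  omega

theorem exists_forall_ecc_le (hG : G.Connected) : ∃ r, ∀ v, ecc G r ≤ ecc G v :=
  have := hG.nonempty
  Finite.exists_min (ecc G)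

end Distance

/-- A breadth-first search tree of `G` with root `r`, encoded by its parent function, which fixes
the root. -/
structure BFSTree {V : Type*} (G : SimpleGraph V) (r : V) where
  par : V → V
  par_root : par r = r
  adj : ∀ v, v ≠ r → G.Adj (par v) v
  dist_eq : ∀ v, v ≠ r → G.dist r v = G.dist r (par v) + 1

theorem exists_bfsTree {V : Type*} {G : SimpleGraph V} (hG : G.Connected) (r : V) :
    Nonempty (BFSTree G r) := by
  have hpar : ∀ v, v ≠ r → ∃ p, G.Adj p v ∧ G.dist r v = G.dist r p + 1 := by
    intro v hv
    obtain ⟨W, hW⟩ := hG.exists_walk_length_eq_dist v r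
    cases W with
    | nil => exact absurd rfl hv
    | @cons _ p _ hvp W =>
      have htail := SimpleGraph.dist_le W
      have htriangle := hG.dist_triangle (u := v) (v := p) (w := r)
      rw [SimpleGraph.dist_eq_one_iff_adj.2 hvp] at htriangle
      rw [SimpleGraph.Walk.length_cons] at hW
      refine ⟨p, hvp.symm, ?_⟩
      rw [SimpleGraph.dist_comm (u := r), SimpleGraph.dist_comm (u := r)]
      omega
  classical
  choose! f hadj hdist using hpar
  exact ⟨⟨fun v => if v = r then r else f v, if_pos rfl, fun v hv => by simpa [hv] using hadj v hv,
    fun v hv => by simpa [hv] using hdist v hv⟩⟩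

namespace BFSTree

variable {V : Type*} {G G' : SimpleGraph V} {r : V} (B : BFSTree G r) {a v x y z : V}

theorem dist_par (v : V) : G.dist r (B.par v) = G.dist r v - 1 := by
  by_cases hv : v = r
  · simp [hv, B.par_root]
  · rw [B.dist_eq v hv, Nat.add_sub_cancel]

theorem dist_iterate (k : ℕ) (v : V) : G.dist r (B.par^[k] v) = G.dist r v - k := by
  induction k with
  | zero => rfl
  | succ k ih => rw [Function.iterate_succ_apply', B.dist_par, ih, Nat.sub_sub]

include B in
theorem dist_pos (h : v ≠ r) : 0 < G.dist r v := B.dist_eq v h ▸ Nat.succ_pos _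

include B in
theorem eq_root_of_dist_eq_zero (h : G.dist r v = 0) : v = r :=
  by_contra fun hv => (B.dist_pos hv).ne' h

theorem par_par_ne (h : v ≠ r) : B.par (B.par v) ≠ v := fun heq => by
  have := B.dist_pos h
  have := B.dist_iterate 2 v
  rw [show B.par^[2] v = v from heq] at this
  omega

include B in
theorem induction {P : V → Prop} (root : P r) (step : ∀ v, v ≠ r → P (B.par v) → P v) (v : V) :
    P v := by
  induction hn : G.dist r v generalizing v with
  | zero => exact B.eq_root_of_dist_eq_zero hn ▸ root
  | succ n ih =>
    have hv : v ≠ r := by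
      rintro rfl
      simp at hn
    exact step v hv (ih _ (by rw [B.dist_par, hn, Nat.add_sub_cancel]))

include B in
theorem connected : G.Connected := by
  have hroot (v : V) : G.Reachable r v := by
    induction v using B.induction with
    | root => exact .refl r
    | step v hv ih => exact ih.trans (B.adj v hv).reachable
  exact SimpleGraph.connected_iff_exists_forall_reachable G |>.2 ⟨r, hroot⟩

theorem dist_par_eq_one (h : v ≠ r) : G.dist (B.par v) v = 1 :=
  SimpleGraph.dist_eq_one_iff_adj.2 (B.adj v h)

/-- The vertex `a` lies on the tree path from `z` to the root. -/
def IsAncestor (a z : V) : Prop := ∃ k, B.par^[k] z = a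

variable {B}

theorem IsAncestor.of_par (h : B.IsAncestor a (B.par z)) : B.IsAncestor a z :=
  h.imp' Nat.succ fun _ hk => hk

theorem IsAncestor.par_left (h : B.IsAncestor a z) : B.IsAncestor (B.par a) z := by
  obtain ⟨k, rfl⟩ := h
  exact ⟨k + 1, Function.iterate_succ_apply' _ _ _⟩

theorem IsAncestor.par (h : B.IsAncestor a z) (hz : z ≠ a) : B.IsAncestor a (B.par z) := by
  obtain ⟨_ | k, hk⟩ := h
  · exact absurd hk hz
  · exact ⟨k, hk⟩

theorem IsAncestor.iterate_sub (h : B.IsAncestor a z) : B.par^[G.dist r z - G.dist r a] z = a := by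
  obtain ⟨k, rfl⟩ := h
  rw [B.dist_iterate]
  by_cases hk : k ≤ G.dist r z
  · rw [Nat.sub_sub_self hk]
  · have hroot (j : ℕ) (hj : G.dist r z ≤ j) : B.par^[j] z = r :=
      B.eq_root_of_dist_eq_zero (by rw [B.dist_iterate]; omega)
    rw [hroot _ (by omega), hroot _ (by omega)]

variable (B)

theorem isAncestor_self (v : V) : B.IsAncestor v v := ⟨0, rfl⟩

theorem edist_iterate_le (h : ∀ v, v ≠ r → G'.Adj (B.par v) v) (k : ℕ) (z : V) :
    G'.edist z (B.par^[k] z) ≤ k := by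
  induction k with
  | zero => simp
  | succ k ih =>
    rw [Function.iterate_succ_apply']
    by_cases hr : B.par^[k] z = r
    · rw [hr, B.par_root, ← hr]
      exact ih.trans (by exact_mod_cast k.le_succ)
    · exact edist_le_of_adj (h _ hr).symm ih le_rfl

/-- The vertices `x` and `y` are joined by an edge outside the tree. -/
def NonTree (x y : V) : Prop := G.Adj x y ∧ B.par x ≠ y ∧ B.par y ≠ x

variable {B}

theorem NonTree.symm (h : B.NonTree x y) : B.NonTree y x := ⟨h.1.symm, h.2.2, h.2.1⟩

variable (B)

theorem isTree_iff [Finite V] : G.IsTree ↔ ∀ x y, ¬ B.NonTree x y := by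
  set F : Set (Sym2 V) := (fun v => s(B.par v, v)) '' {r}ᶜ
  have hF : F ⊆ G.edgeSet := by
    rintro _ ⟨v, hv, rfl⟩
    exact B.adj v hv
  have hcard : F.ncard + 1 = Nat.card V := by
    rw [Set.InjOn.ncard_image, ← Set.ncard_singleton r, add_comm, Set.ncard_add_ncard_compl]
    rintro v - w hw h
    rcases Sym2.eq_iff.1 h with ⟨-, h⟩ | ⟨h, h'⟩
    · exact h
    · exact absurd (h' ▸ h) (B.par_par_ne hw)
  have htree : G.IsTree ↔ F = G.edgeSet := by
    rw [SimpleGraph.isTree_iff_connected_and_card, ← hcard, Nat.card_coe_set_eq]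
    refine ⟨fun h => Set.eq_of_subset_of_ncard_le hF (by omega), fun h => ⟨B.connected, by rw [h]⟩⟩
  rw [htree]
  refine ⟨fun h x y hxy => ?_, fun h => hF.antisymm fun e he => ?_⟩
  · obtain ⟨v, -, hv⟩ := h.symm ▸ (SimpleGraph.mem_edgeSet G).2 hxy.1
    rcases Sym2.eq_iff.1 hv with ⟨rfl, rfl⟩ | ⟨rfl, rfl⟩
    exacts [hxy.2.2 rfl, hxy.2.1 rfl]
  · induction e with | _ x y
    have hne (v w : V) (hvw : G.Adj v w) (h : B.par v = w) : v ≠ r := by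
      rintro rfl
      exact hvw.ne (B.par_root ▸ h)
    have hxy : G.Adj x y := he
    by_cases hx : B.par x = y
    · exact ⟨x, hne x y hxy hx, hx ▸ Sym2.eq_swap⟩
    · by_cases hy : B.par y = x
      · exact ⟨y, hne y x hxy.symm hy, hy ▸ rfl⟩
      · exact absurd ⟨hxy, hx, hy⟩ (h x y)

include B in
theorem edist_add_one_le_of_exit {H : Set V} (hr : r ∈ H)
    (hout : ∀ p q, p ∉ H → q ∉ H → G.Adj p q → G'.Adj p q)
    (hexit : ∀ p q, p ∈ H → q ∉ H → G.Adj p q → G'.edist v q ≤ G.dist r p) (hz : z ∉ H) :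
    G'.edist v z + 1 ≤ G.dist r z := by
  induction z using B.induction with
  | root => exact absurd hr hz
  | step z hzr ih =>
    rw [B.dist_eq z hzr, Nat.cast_add_one]
    gcongr
    by_cases hp : B.par z ∈ H
    · exact hexit _ _ hp hz (B.adj z hzr)
    · have hpz := SimpleGraph.edist_eq_one_iff_adj.2 (hout _ _ hp hz (B.adj z hzr))
      exact SimpleGraph.edist_triangle.trans (hpz.symm ▸ ih hp)

variable {B}

theorem IsAncestor.dist_add_dist_le (h : B.IsAncestor a z) :
    G.dist r a + G.dist a z ≤ G.dist r z := by
  have hza := B.edist_iterate_le (G' := G) B.adj (G.dist r z - G.dist r a) z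
  rw [h.iterate_sub, ← (B.connected z a).coe_dist_eq_edist, Nat.cast_le] at hza
  obtain ⟨k, rfl⟩ := h
  rw [SimpleGraph.dist_comm (v := z)]
  rw [B.dist_iterate] at hza ⊢
  omega

variable (B)

theorem dist_add_dist_le_of_isTree [Finite V] (hG : G.IsTree) (ha : B.par a = r)
    (hv : B.IsAncestor a v) (hz : ¬ B.IsAncestor a z) : G.dist r v + G.dist r z ≤ G.dist v z := by
  rw [SimpleGraph.dist_comm (u := r) (v := v)]
  refine dist_add_dist_le_of_boundary B.connected (H := {w | B.IsAncestor a w}) hv hz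
    fun p q hp hq hpq => ?_
  have hqp : B.par q ≠ p := fun h => hq (.of_par (h ▸ hp))
  have hpq : B.par p = q := by_contra fun h => B.isTree_iff.1 hG p q ⟨hpq, h, hqp⟩
  have hpa : p = a := by_contra fun h => hq (hpq ▸ hp.par h)
  rw [← hpq, hpa, ha]

-- The farthest vertex `f` from `r` and the farthest vertex `z` from the neighbour of `r` towards
-- `f` lie in different branches at `r`.
include B in
theorem exists_two_mul_ecc_le [Finite V] (hG : G.IsTree) (hr : ∀ v, ecc G r ≤ ecc G v) :
    ∃ f, 2 * ecc G r ≤ ecc G f + 1 := by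
  obtain ⟨f, hf⟩ := exists_dist_eq_ecc B.connected r
  by_cases hfr : f = r
  · rw [← hf, hfr, SimpleGraph.dist_self]
    exact ⟨r, Nat.zero_le _⟩
  have hpos := B.dist_pos hfr
  obtain ⟨c, hc⟩ : ∃ c, c = B.par^[ecc G r - 1] f := ⟨_, rfl⟩
  have hrc : G.dist r c = 1 := by
    rw [hc, B.dist_iterate]
    omega
  have hcr : B.par c = r := B.eq_root_of_dist_eq_zero (by rw [B.dist_par, hrc])
  obtain ⟨z, hz⟩ := exists_dist_eq_ecc B.connected c
  have hzc := hr c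
  have hrz := dist_le_ecc B.connected r z
  have hcz : ¬ B.IsAncestor c z := fun hcz => by
    have := hcz.dist_add_dist_le
    omega
  have hfz := B.dist_add_dist_le_of_isTree hG hcr ⟨_, hc.symm⟩ hcz
  have htriangle := B.connected.dist_triangle (u := c) (v := r) (w := z)
  have := dist_le_ecc B.connected f z
  rw [SimpleGraph.dist_comm (u := c) (v := r), hrc] at htriangle
  exact ⟨f, by omega⟩

end BFSTree

section Rewire

variable {V : Type*} {G : SimpleGraph V} {r a p q z : V} {X A : Finset V} {c : ℕ}

/-- The graph `G` after a change of strategy of the agent `v`: the edges from `v` to `X` are removed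
and edges from `v` to `A` are added. -/
def rewire (G : SimpleGraph V) (v : V) (X A : Finset V) : SimpleGraph V :=
  G.deleteEdges ((s(v, ·)) '' X) ⊔ SimpleGraph.fromRel fun p q => p = v ∧ q ∈ A

theorem rewire_adj_of_adj (h : G.Adj p q) (hp : p = a → q ∉ X) (hq : q = a → p ∉ X) :
    (rewire G a X A).Adj p q := by
  refine Or.inl (SimpleGraph.deleteEdges_adj.2 ⟨h, ?_⟩)
  rintro ⟨b, hb, heq⟩
  rcases Sym2.eq_iff.1 heq with ⟨rfl, rfl⟩ | ⟨rfl, rfl⟩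
  exacts [hp rfl hb, hq rfl hb]

theorem rewire_adj_of_mem (h : z ∈ A) (hz : z ≠ a) : (rewire G a X A).Adj a z :=
  Or.inr ⟨hz.symm, Or.inl ⟨rfl, h⟩⟩

theorem edist_rewire_le_one (h : z ∈ A) : (rewire G a X A).edist a z ≤ 1 :=
  SimpleGraph.edist_le_one_iff_adj_or_eq.2 <|
    (eq_or_ne a z).symm.imp_left fun hz => rewire_adj_of_mem h hz.symm

namespace BFSTree

variable (B : BFSTree G r) {x y : V}

-- Up to the edges to `X`, the tree paths survive; the shifted bound `G.dist r z + c` propagates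
-- along them and restarts with `0` at `a`.
theorem edist_rewire_le (hroot : (rewire G a X A).edist a r ≤ c)
    (hX : ∀ b ∈ X, b ≠ r → B.par b = a → B.IsAncestor b z →
      (rewire G a X A).edist a b ≤ (G.dist r b + c : ℕ)) :
    (rewire G a X A).edist a z ≤ (G.dist r z + c : ℕ) := by
  induction z using B.induction with
  | root => simpa using hroot
  | step z hz ih =>
    by_cases hza : z = a
    · simp [hza]
    · by_cases hzX : B.par z = a ∧ z ∈ X
      · exact hX z hzX.2 hz hzX.1 (B.isAncestor_self z)
      · refine edist_le_of_adj ?_ (ih fun b hb hbr hba hbz => hX b hb hbr hba hbz.of_par)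
          (by rw [B.dist_eq z hz]; omega)
        exact rewire_adj_of_adj (B.adj z hz) (fun h h' => hzX ⟨h, h'⟩) fun h => absurd h hza

theorem edist_rewire_le_add_one (hr : r ∈ A) (hz : ¬ B.IsAncestor a z) :
    (rewire G a X A).edist a z ≤ (G.dist r z + 1 : ℕ) :=
  B.edist_rewire_le (by simpa using edist_rewire_le_one hr)
    fun _ _ _ hb hbz => absurd (hb ▸ hbz.par_left) hz

theorem edist_rewire_iterate_le (hr : r ∈ A) (hxy : G.Adj x y) (hy : ¬ B.IsAncestor a y) {j : ℕ}
    (hx : ∀ l ≤ j, B.par^[l] x ≠ a) :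
    (rewire G a X A).edist a (B.par^[j] x) ≤ (G.dist r y + 2 + j : ℕ) := by
  have hya : y ≠ a := by
    rintro rfl
    exact hy (B.isAncestor_self y)
  induction j with
  | zero =>
    exact edist_le_of_adj (rewire_adj_of_adj hxy.symm (absurd · hya) (absurd · (hx 0 le_rfl)))
      (B.edist_rewire_le_add_one hr hy) le_rfl
  | succ j ih =>
    have hxj := ih fun l hl => hx l (hl.trans j.le_succ)
    have hj := hx j j.le_succ
    have hj' := hx (j + 1) le_rfl
    rw [Function.iterate_succ_apply'] at hj' ⊢
    by_cases hjr : B.par^[j] x = r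
    · rw [hjr] at hxj
      rw [hjr, B.par_root]
      exact hxj.trans (by exact_mod_cast Nat.le_succ _)
    · exact edist_le_of_adj
        (rewire_adj_of_adj (B.adj _ hjr).symm (absurd · hj) (absurd · hj')) hxj le_rfl

variable {B}

theorem NonTree.rewire_adj_par (h : B.NonTree x y) (hz : z ≠ r) :
    (rewire G x {y} A).Adj (B.par z) z := by
  refine rewire_adj_of_adj (B.adj z hz) ?_ ?_
  · rintro rfl hy
    exact h.2.2 (Finset.mem_singleton.1 hy ▸ rfl)
  · rintro rfl hy
    exact h.2.1 (Finset.mem_singleton.1 hy)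

end BFSTree

end Rewire

section Nash

variable {V : Type*} {α : ℝ≥0} {s s' : Profile V} {v w q : V} {b c : ℕ}

theorem agentCost_le_of_edist_le (h : ∀ z, (graph s).edist v z ≤ b) :
    agentCost α s v ≤ (α * (s v).1.card + b : ℝ≥0) := by
  rw [agentCost, ENNReal.coe_add, ENNReal.coe_mul, ENNReal.coe_natCast, ENNReal.coe_natCast]
  gcongr
  exact (ENat.toENNReal_le.2 (iSup_le h)).trans_eq (ENat.toENNReal_coe b)

theorem agentCost_eq_top (h : ¬ (graph s).Connected) : agentCost α s v = ⊤ := by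
  have := SimpleGraph.eccent_eq_top_of_not_connected h v
  rw [SimpleGraph.eccent] at this
  rw [agentCost, this, ENat.toENNReal_top, add_top]

variable [Finite V]

theorem agentCost_of_connected (hG : (graph s).Connected) (v : V) :
    agentCost α s v = (α * (s v).1.card + ecc (graph s) v : ℝ≥0) := by
  have h : (⨆ u, (graph s).edist v u : ℕ∞) = ecc (graph s) v := (coe_ecc hG v).symm
  rw [agentCost, h, ENat.toENNReal_coe]
  push_cast
  rfl

theorem IsNash.connected [Nonempty V] (hs : IsNash α s) : (graph s).Connected := by
  classical
  have := Fintype.ofFinite V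
  obtain ⟨v⟩ := ‹Nonempty V›
  let s' : Profile V := Function.update s v ⟨Finset.univ.erase v, Finset.notMem_erase v _⟩
  have hle : agentCost α s' v ≤ _ := agentCost_le_of_edist_le (b := 1) fun z => by
    refine SimpleGraph.edist_le_one_iff_adj_or_eq.2 ?_
    by_cases hz : v = z
    · exact Or.inr hz
    · exact Or.inl (Or.inr (by simp [s', Ne.symm hz]))
  by_contra hG
  have := (hs v s' fun u hu => Function.update_of_ne hu _ _).trans hle
  rw [agentCost_eq_top hG, top_le_iff] at this
  exact ENNReal.coe_ne_top this

theorem IsNash.mul_card_add_ecc_le (hs : IsNash α s) (hG : (graph s).Connected)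
    (hs' : ∀ u, u ≠ v → s' u = s u) (hb : ∀ z, (graph s').edist v z ≤ b) :
    (α : ℝ) * (s v).1.card + ecc (graph s) v ≤ α * (s' v).1.card + b := by
  have h := (hs v s' hs').trans (agentCost_le_of_edist_le hb)
  rw [agentCost_of_connected hG, ENNReal.coe_le_coe] at h
  exact_mod_cast h

omit [Finite V] in
theorem rewire_graph_le [DecidableEq V] {X A : Finset V} (hs' : ∀ u, u ≠ v → s' u = s u)
    (hv : (s' v).1 = ((s v).1 \ X) ∪ A.erase v) : rewire (graph s) v X A ≤ graph s' := by
  have hkeep (p q : V) (h : q ∈ (s p).1) (hX : p = v → q ∉ X) : q ∈ (s' p).1 := by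
    by_cases hp : p = v
    · subst hp
      simp [hv, h, hX rfl]
    · rwa [hs' p hp]
  have hnew (q : V) (hq : q ≠ v) (hA : q ∈ A) : q ∈ (s' v).1 := by simp [hv, hq, hA]
  rintro p q (h | ⟨hpq, ⟨rfl, hq⟩ | ⟨rfl, hp⟩⟩)
  · obtain ⟨h, hX⟩ := SimpleGraph.deleteEdges_adj.1 h
    refine h.imp (fun hp => hkeep q p hp ?_) fun hq => hkeep p q hq ?_
    · rintro rfl h'
      exact hX ⟨p, h', Sym2.eq_swap⟩
    · rintro rfl h'
      exact hX ⟨q, h', rfl⟩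
  · exact Or.inr (hnew q hpq.symm hq)
  · exact Or.inl (hnew p hpq hp)

theorem IsNash.mul_card_add_ecc_le_of_rewire (hs : IsNash α s) (hG : (graph s).Connected)
    {X A : Finset V} (hX : X ⊆ (s v).1) (hb : ∀ z, (rewire (graph s) v X A).edist v z ≤ b) :
    (α : ℝ) * X.card + ecc (graph s) v ≤ α * A.card + b := by
  classical
  set S : Finset V := ((s v).1 \ X) ∪ A.erase v with hS
  let s' : Profile V := Function.update s v ⟨S, by simp [S, (s v).2]⟩
  have hs' (u : V) (hu : u ≠ v) : s' u = s u := Function.update_of_ne hu _ _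
  have hsv : (s' v).1 = S := by simp [s']
  have h := hs.mul_card_add_ecc_le hG hs' fun z =>
    (SimpleGraph.edist_anti (rewire_graph_le hs' hsv)).trans (hb z)
  have hcard : S.card + X.card ≤ (s v).1.card + A.card := by
    have hunion := Finset.card_union_le ((s v).1 \ X) (A.erase v)
    rw [← hS] at hunion
    have hsdiff := Finset.card_sdiff_add_card_eq_card hX
    have herase := Finset.card_erase_le (s := A) (a := v)
    omega
  have hcard' : (S.card : ℝ) + X.card ≤ (s v).1.card + A.card := by exact_mod_cast hcard
  rw [hsv] at h
  nlinarith [mul_le_mul_of_nonneg_left hcard' α.2]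

theorem IsNash.mul_card_add_ecc_le_of_dist (hs : IsNash α s) (hG : (graph s).Connected)
    {X A : Finset V} (hX : X ⊆ (s v).1)
    (hb : ∀ z, (rewire (graph s) v X A).edist v z ≤ ((graph s).dist q z + c : ℕ)) :
    (α : ℝ) * X.card + ecc (graph s) v ≤ α * A.card + (ecc (graph s) q + c : ℕ) :=
  hs.mul_card_add_ecc_le_of_rewire hG hX fun z =>
    (hb z).trans (by exact_mod_cast Nat.add_le_add_right (dist_le_ecc hG q z) c)

theorem IsNash.notMem_of_mem (hs : IsNash α s) (hα : 0 < α) (h : w ∈ (s v).1) : v ∉ (s w).1 := by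
  classical
  intro hw
  have := Nonempty.intro v
  let s' : Profile V := Function.update s v
    ⟨(s v).1.erase w, fun h => (s v).2 (Finset.mem_of_mem_erase h)⟩
  have hs' (u : V) (hu : u ≠ v) : s' u = s u := Function.update_of_ne hu _ _
  have hwv : w ≠ v := fun h' => (s v).2 (h' ▸ h)
  have hsv : (s' v).1 = (s v).1.erase w := by simp [s']
  have hmem (p q : V) (hpq : q ∈ (s p).1) : (graph s').Adj p q := by
    by_cases hp : p = v
    · subst hp
      by_cases hq : q = w
      · exact Or.inl (by rwa [hq, hs' w hwv])
      · exact Or.inr (by rw [hsv]; exact Finset.mem_erase.2 ⟨hq, hpq⟩)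
    · exact Or.inr (by rwa [hs' p hp])
  have hle : graph s ≤ graph s' := fun p q hpq => hpq.elim (fun h => (hmem q p h).symm) (hmem p q)
  have hcost := hs.mul_card_add_ecc_le hs.connected hs' fun z =>
    (SimpleGraph.edist_anti hle).trans (edist_le_ecc hs.connected v z)
  rw [add_le_add_iff_right, mul_le_mul_iff_right₀ (by exact_mod_cast hα), hsv, Nat.cast_le] at hcost
  exact (Finset.card_erase_lt_of_mem h).not_ge hcost

theorem IsNash.ecc_le_add (hs : IsNash α s) (q v : V) :
    (ecc (graph s) v : ℝ) ≤ α + ecc (graph s) q + 1 := by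
  have := Nonempty.intro v
  obtain ⟨B⟩ := exists_bfsTree hs.connected q
  have h := hs.mul_card_add_ecc_le_of_dist (v := v) (q := q) hs.connected (X := ∅) (A := {q})
    (c := 1) (Finset.empty_subset _) fun z => B.edist_rewire_le
      (by simpa using edist_rewire_le_one (Finset.mem_singleton_self q)) (by simp)
  simp only [Finset.card_empty, Finset.card_singleton] at h
  push_cast at h
  linarith

theorem IsNash.ecc_le_of_par_ne (hs : IsNash α s) (B : BFSTree (graph s) q)
    (hw : w ∈ (s v).1) (hpar : B.par w ≠ v) : ecc (graph s) v ≤ ecc (graph s) q + 1 := by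
  have h := hs.mul_card_add_ecc_le_of_dist B.connected (X := {w}) (A := {q}) (c := 1)
    (Finset.singleton_subset_iff.2 hw) fun z => B.edist_rewire_le
      (by simpa using edist_rewire_le_one (Finset.mem_singleton_self q))
      fun b hb _ hbv => absurd hbv (Finset.mem_singleton.1 hb ▸ hpar)
  simp only [Finset.card_singleton] at h
  exact_mod_cast le_of_add_le_add_left h

end Nash

/-- A breadth-first search tree of the graph of an equilibrium, rooted at a vertex of minimal
eccentricity. -/
structure CentralTree {V : Type*} (α : ℝ≥0) (s : Profile V) (r : V) extends
    BFSTree (graph s) r where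
  nash : IsNash α s
  ecc_root_le : ∀ v, ecc (graph s) r ≤ ecc (graph s) v

theorem IsNash.exists_centralTree {V : Type*} [Finite V] [Nonempty V] {α : ℝ≥0} {s : Profile V}
    (hs : IsNash α s) : ∃ r, Nonempty (CentralTree α s r) := by
  obtain ⟨r, hr⟩ := exists_forall_ecc_le hs.connected
  obtain ⟨B⟩ := exists_bfsTree hs.connected r
  exact ⟨r, ⟨B, hs, hr⟩⟩

namespace CentralTree

variable {V : Type*} {α : ℝ≥0} {s : Profile V} {r : V}

/-- The agent `x` pays for an edge to `y` outside the tree. -/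
def BuysNonTree (T : CentralTree α s r) (x y : V) : Prop := T.NonTree x y ∧ y ∈ (s x).1

/-- The walk that enters `x` by the edge from `y` and then climbs to the root along the tree; it
has `y` at position `0` and `x` at position `1`. -/
def climb (T : CentralTree α s r) (x y : V) : ℕ → V
  | 0 => y
  | i + 1 => T.par^[i] x

/-- An edge from `a` to `b`, if paid for by `a`, is redundant to depth `d` when it is not the tree
edge to a child `b`, or when it is one of the first `d + 1` edges of the climb from a non-tree edge
that the lower end pays for. Dropping such edges while buying one to the root increases the
distances to at most `2 * d + 1` more than those from the root. -/
def Redundant (T : CentralTree α s r) (d : ℕ) (a b : V) : Prop :=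
  T.par b ≠ a ∨ ∃ x y i, i ≤ d ∧ T.BuysNonTree x y ∧ T.climb x y (i + 1) = a ∧ T.climb x y i = b

variable {T : CentralTree α s r} {a b b₁ b₂ x y x' y' : V} {X A : Finset V} {d i i' : ℕ}

theorem par_climb (i : ℕ) : T.par (T.climb x y (i + 1)) = T.climb x y (i + 2) :=
  (Function.iterate_succ_apply' _ _ _).symm

theorem dist_climb (i : ℕ) :
    (graph s).dist r (T.climb x y (i + 1)) = (graph s).dist r x - i := T.dist_iterate i x

theorem isAncestor_climb (i : ℕ) : T.IsAncestor (T.climb x y (i + 1)) x := ⟨i, rfl⟩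

theorem dist_le_add_one_of_nonTree (h : T.NonTree x y) :
    (graph s).dist r y ≤ (graph s).dist r x + 1 :=
  SimpleGraph.dist_eq_one_iff_adj.2 h.1 ▸ T.connected.dist_triangle

theorem BuysNonTree.redundant (h : T.BuysNonTree x y) (hi : i ≤ d) :
    T.Redundant d (T.climb x y (i + 1)) (T.climb x y i) :=
  Or.inr ⟨x, y, i, hi, h, rfl, rfl⟩

variable [Finite V]

namespace BuysNonTree

theorem le_dist (h : T.BuysNonTree x y) : α ≤ (graph s).dist r x := by
  have hroot : (rewire (graph s) x {y} ∅).edist x r ≤ (graph s).dist r x := by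
    have hx := T.edist_iterate_le (fun _ hv => h.1.rewire_adj_par (A := ∅) hv)
      ((graph s).dist r x) x
    rwa [T.eq_root_of_dist_eq_zero (v := T.par^[_] x) (by rw [T.dist_iterate, Nat.sub_self])] at hx
  have hcost := T.nash.mul_card_add_ecc_le_of_dist T.connected (A := ∅)
    (Finset.singleton_subset_iff.2 h.2) fun z => T.edist_rewire_le hroot
      fun b hb _ hbx => absurd hbx (Finset.mem_singleton.1 hb ▸ h.1.2.2)
  have hr : (ecc (graph s) r : ℝ) ≤ ecc (graph s) x := by exact_mod_cast T.ecc_root_le x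
  simp only [Finset.card_singleton, Finset.card_empty] at hcost
  push_cast at hcost
  rw [← NNReal.coe_le_coe, NNReal.coe_natCast]
  linarith

theorem lt_dist (h : T.BuysNonTree x y) (hi : i < α) : i < (graph s).dist r x := by
  exact_mod_cast hi.trans_le h.le_dist

theorem climb_ne_root (h : T.BuysNonTree x y) (hi : i < α) : T.climb x y (i + 1) ≠ r := fun hr => by
  have := h.lt_dist hi
  have := T.dist_climb (x := x) (y := y) i
  rw [hr, SimpleGraph.dist_self] at this
  omega

theorem ecc_le (h : T.BuysNonTree x y) : ecc (graph s) x ≤ ecc (graph s) r + 1 :=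
  T.nash.ecc_le_of_par_ne T.toBFSTree h.2 h.1.2.2

-- Otherwise the edge closes a cycle of length at most `2 * i + 2`, and is not worth its price.
theorem not_isAncestor (h : T.BuysNonTree x y) (hi : (2 * i : ℕ) < α) :
    ¬ T.IsAncestor (T.climb x y (i + 1)) y := fun hy => by
  have hyx := dist_le_add_one_of_nonTree h.1
  have hx := h.lt_dist hi
  have hcycle : (rewire (graph s) x {y} ∅).edist x y ≤ (2 * i + 1 : ℕ) := by
    have hx' := T.edist_iterate_le (fun _ hv => h.1.rewire_adj_par (A := ∅) hv) i x
    have hy' := T.edist_iterate_le (fun _ hv => h.1.rewire_adj_par (A := ∅) hv)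
      ((graph s).dist r y - (graph s).dist r (T.climb x y (i + 1))) y
    rw [hy.iterate_sub, SimpleGraph.edist_comm] at hy'
    refine (edist_le_of_edist_le hx' hy').trans ?_
    rw [dist_climb]
    exact_mod_cast (by omega)
  obtain ⟨B⟩ := exists_bfsTree T.connected x
  have hcost := T.nash.mul_card_add_ecc_le_of_dist T.connected (A := ∅) (c := 2 * i)
    (Finset.singleton_subset_iff.2 h.2) fun z => B.edist_rewire_le (by simp) fun b hb _ _ _ => by
      rw [Finset.mem_singleton.1 hb, SimpleGraph.dist_eq_one_iff_adj.2 h.1.1, add_comm]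
      exact hcycle
  simp only [Finset.card_singleton, Finset.card_empty] at hcost
  rw [← NNReal.coe_lt_coe, NNReal.coe_natCast] at hi
  push_cast at hcost hi
  linarith

end BuysNonTree

-- The detour to `b` leads from the root through `y` and `x`, for the edge `x y` outside the tree.
theorem Redundant.edist_rewire_le (h : T.Redundant d a b) (hd : (2 * d : ℕ) < α) (hb : b ≠ r)
    (hba : T.par b = a) (hr : r ∈ A) :
    (rewire (graph s) a X A).edist a b ≤ ((graph s).dist r b + (2 * d + 1) : ℕ) := by
  obtain ⟨x, y, i, hi, hxy, rfl, rfl⟩ := h.resolve_left (not_not.2 hba)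
  obtain _ | j := i
  · exact absurd hba hxy.1.2.2
  have hay := hxy.not_isAncestor (i := j + 1) ((Nat.cast_le.2 (by omega)).trans_lt hd)
  have hdist := T.dist_climb (x := x) (y := y) j
  have hpos := T.dist_pos hb
  have hne (l : ℕ) (hl : l ≤ j) : T.par^[l] x ≠ T.climb x y (j + 2) := fun h => by
    have hl' := T.dist_iterate l x
    have hj := T.dist_climb (x := x) (y := y) (j + 1)
    rw [h, hj] at hl'
    omega
  refine (T.edist_rewire_iterate_le hr hxy.1.1 hay hne).trans ?_
  have := dist_le_add_one_of_nonTree hxy.1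
  exact_mod_cast (by omega)

theorem eq_of_redundant (hα : (2 * d + 1 : ℕ) < α) (h₁ : b₁ ∈ (s a).1) (h₂ : b₂ ∈ (s a).1)
    (hb₁ : T.Redundant d a b₁) (hb₂ : T.Redundant d a b₂) : b₁ = b₂ := by
  classical
  by_contra hne
  have hd : (2 * d : ℕ) < α := (Nat.cast_le.2 (Nat.le_succ _)).trans_lt hα
  have hcost := T.nash.mul_card_add_ecc_le_of_dist T.connected (A := {r}) (c := 2 * d + 1)
    (Finset.insert_subset h₁ (Finset.singleton_subset_iff.2 h₂)) fun z => T.edist_rewire_le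
      ((edist_rewire_le_one (Finset.mem_singleton_self r)).trans (by exact_mod_cast by omega))
      fun b hb hbr hba _ => by
        have hred : T.Redundant d a b := by
          rcases Finset.mem_insert.1 hb with rfl | hb
          exacts [hb₁, Finset.mem_singleton.1 hb ▸ hb₂]
        exact hred.edist_rewire_le hd hbr hba (Finset.mem_singleton_self r)
  have hr : (ecc (graph s) r : ℝ) ≤ ecc (graph s) a := by exact_mod_cast T.ecc_root_le a
  rw [Finset.card_pair hne, Finset.card_singleton] at hcost
  rw [← NNReal.coe_lt_coe, NNReal.coe_natCast] at hα
  push_cast at hcost hα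
  linarith

namespace BuysNonTree

theorem climb_mem (h : T.BuysNonTree x y) (hα : (2 * d + 1 : ℕ) < α) (hi : i ≤ d + 1) :
    T.climb x y i ∈ (s (T.climb x y (i + 1))).1 := by
  induction i with
  | zero => exact h.2
  | succ i ih =>
    have hlt (j : ℕ) (hj : j ≤ d) : (j : ℝ≥0) < α :=
      (Nat.cast_le.2 (by omega)).trans_lt hα
    have hroot := h.climb_ne_root (hlt i (by omega))
    rw [← par_climb]
    refine (T.adj _ hroot).resolve_left fun hpar => ?_
    have heq := eq_of_redundant hα hpar (ih (by omega)) (Or.inl (T.par_par_ne hroot))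
      (h.redundant (by omega))
    obtain _ | j := i
    · exact h.1.2.1 heq
    · exact T.par_par_ne (h.climb_ne_root (hlt j (by omega))) (by rw [par_climb]; exact heq)

theorem climb_inj (h : T.BuysNonTree x y) (h' : T.BuysNonTree x' y') (hα : (2 * d + 1 : ℕ) < α)
    (hi : i ≤ d) (hi' : i' ≤ d) (heq : T.climb x y (i + 1) = T.climb x' y' (i' + 1)) :
    x = x' ∧ y = y' ∧ i = i' := by
  have hprev {i i' : ℕ} (hi : i ≤ d) (hi' : i' ≤ d)
      (heq : T.climb x y (i + 1) = T.climb x' y' (i' + 1)) : T.climb x y i = T.climb x' y' i' :=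
    eq_of_redundant hα (h.climb_mem hα (by omega)) (heq ▸ h'.climb_mem hα (by omega))
      (h.redundant hi) (heq ▸ h'.redundant hi')
  induction i generalizing i' with
  | zero =>
    obtain _ | j := i'
    · exact ⟨heq, hprev hi hi' heq, rfl⟩
    · have hy : T.par y = T.par (T.climb x' y' (j + 1)) := congrArg T.par (hprev hi hi' heq)
      exact absurd (hy.trans ((par_climb j).trans heq.symm)) h.1.2.2
  | succ i ih =>
    obtain _ | j := i'
    · have hy' : T.par y' = T.par (T.climb x y (i + 1)) := congrArg T.par (hprev hi hi' heq).symm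
      exact absurd (hy'.trans ((par_climb i).trans heq)) h'.1.2.2
    · obtain ⟨hx, hy, rfl⟩ := ih (by omega) (i' := j) (by omega) (hprev hi hi' heq)
      exact ⟨hx, hy, rfl⟩

end BuysNonTree

end CentralTree

namespace BFSTree

variable {V : Type*} {G G' : SimpleGraph V} {r : V} {B : BFSTree G r}
  {u v w w₁ w₂ w₃ p q x y z : V} {c : ℕ}

/-- The vertices other than the root that lie on a cycle formed by an edge outside the tree and the
tree paths from its ends to the root. -/
def Core (B : BFSTree G r) (z : V) : Prop := z ≠ r ∧ ∃ x y, B.NonTree x y ∧ B.IsAncestor z x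

/-- A neighbour of `u` in the core that is not its parent: a child in the core, or the other end of
an edge outside the tree. -/
def Below (B : BFSTree G r) (u z : V) : Prop := (B.Core z ∧ B.par z = u) ∨ B.NonTree u z

/-- `w` is the first vertex of the core on the tree path from `z` to the root, if `w` is in the
core. -/
inductive Hangs (B : BFSTree G r) (w : V) : V → Prop
  | refl : Hangs B w w
  | step {z : V} (hz : ¬ B.Core z) (h : Hangs B w (B.par z)) : Hangs B w z

/-- A descending path `w₁`, `w₂`, `w₃` whose first two vertices have degree two in the core. -/
structure ThinPath (B : BFSTree G r) (w₁ w₂ w₃ : V) : Prop where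
  core₁ : B.Core w₁
  core₂ : B.Core w₂
  par_eq : B.par w₂ = w₁
  adj : G.Adj w₂ w₃
  eq_of_below₁ : ∀ z, B.Below w₁ z → z = w₂
  eq_of_below₂ : ∀ z, B.Below w₂ z → z = w₃

theorem Core.par (h : B.Core z) (hr : B.par z ≠ r) : B.Core (B.par z) := by
  obtain ⟨-, x, y, hxy, hz⟩ := h
  exact ⟨hr, x, y, hxy, hz.par_left⟩

theorem NonTree.core (h : B.NonTree x y) (hr : x ≠ r) : B.Core x :=
  ⟨hr, x, y, h, B.isAncestor_self x⟩

theorem Core.exists_below (h : B.Core u) : ∃ z, B.Below u z := by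
  obtain ⟨hur, x, y, hxy, _ | k, rfl⟩ := h
  · exact ⟨y, Or.inr hxy⟩
  · rw [Function.iterate_succ_apply'] at hur ⊢
    refine ⟨B.par^[k] x, Or.inl ⟨⟨fun hr => hur ?_, x, y, hxy, k, rfl⟩, rfl⟩⟩
    rw [hr, B.par_root]

theorem Core.exists_par_eq_root (h : B.Core z) : ∃ c, B.Core c ∧ B.par c = r := by
  induction z using B.induction with
  | root => exact absurd rfl h.1
  | step z _ ih =>
    by_cases hz : B.par z = r
    exacts [⟨z, h, hz⟩, ih (h.par hz)]

theorem Hangs.ne_root (h : B.Hangs w z) (hw : w ≠ r) : z ≠ r := by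
  induction h with
  | refl => exact hw
  | step _ _ ih =>
    rintro rfl
    exact ih B.par_root

theorem Hangs.edist_add_dist_le (h : B.Hangs w z) (hw : w ≠ r)
    (hadj : ∀ z, z ≠ r → ¬ B.Core z → G'.Adj (B.par z) z) (hv : G'.edist v w ≤ c) :
    G'.edist v z + G.dist r w ≤ (c + G.dist r z : ℕ) := by
  induction h with
  | refl =>
    push_cast
    gcongr
  | @step z hz h ih =>
    have hzr := (Hangs.step hz h).ne_root hw
    have hpz := SimpleGraph.edist_eq_one_iff_adj.2 (hadj z hzr hz)
    calc G'.edist v z + G.dist r w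
        ≤ G'.edist v (B.par z) + 1 + G.dist r w := by
          gcongr
          exact hpz ▸ SimpleGraph.edist_triangle
      _ = G'.edist v (B.par z) + G.dist r w + 1 := add_right_comm _ _ _
      _ ≤ (c + G.dist r (B.par z) : ℕ) + 1 := by gcongr
      _ = (c + G.dist r z : ℕ) := by rw [B.dist_eq z hzr, ← add_assoc, Nat.cast_add_one]

theorem Hangs.eq_of_adj (hp : B.Hangs w p) (hw : B.Core w) (hz : ¬ B.Hangs w z) (h : G.Adj p z) :
    p = w ∧ (z = B.par w ∨ B.Below w z) := by
  have hcore (hzp : B.par z = p) : B.Core z := by_contra fun hc => hz (.step hc (hzp ▸ hp))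
  by_cases hpz : B.par p = z
  · cases hp with
    | refl => exact ⟨rfl, Or.inl hpz.symm⟩
    | step _ hpar => exact absurd (hpz ▸ hpar) hz
  · have hbelow : B.Below p z := by
      by_cases hzp : B.par z = p
      exacts [Or.inl ⟨hcore hzp, hzp⟩, Or.inr ⟨h, hpz, hzp⟩]
    cases hp with
    | refl => exact ⟨rfl, Or.inr hbelow⟩
    | step hpc hpar =>
      have hpr := (Hangs.step hpc hpar).ne_root hw.1
      exact absurd (hbelow.elim (fun h => h.2 ▸ h.1.par (h.2 ▸ hpr)) fun h => h.core hpr) hpc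

namespace ThinPath

theorem eq_of_hangs_of_adj (h : B.ThinPath w₁ w₂ w₃) (hp : B.Hangs w₁ p ∨ B.Hangs w₂ p)
    (hq : ¬ (B.Hangs w₁ q ∨ B.Hangs w₂ q)) (hpq : G.Adj p q) :
    (p = w₁ ∧ q = B.par w₁) ∨ (p = w₂ ∧ q = w₃) := by
  obtain ⟨hq₁, hq₂⟩ := not_or.1 hq
  rcases hp with hp | hp
  · obtain ⟨hpw, hqw | hqw⟩ := hp.eq_of_adj h.core₁ hq₁ hpq
    exacts [Or.inl ⟨hpw, hqw⟩, absurd (h.eq_of_below₁ q hqw ▸ .refl) hq₂]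
  · obtain ⟨hpw, hqw | hqw⟩ := hp.eq_of_adj h.core₂ hq₂ hpq
    exacts [absurd (hqw ▸ h.par_eq ▸ .refl) hq₁, Or.inr ⟨hpw, h.eq_of_below₂ q hqw⟩]

theorem par_par_ne (h : B.ThinPath w₁ w₂ w₃) : B.par w₁ ≠ w₂ :=
  h.par_eq ▸ B.par_par_ne h.core₂.1

theorem edist_rewire_le (h : B.ThinPath w₁ w₂ w₃) :
    (rewire G (B.par w₁) {w₁} {w₃}).edist (B.par w₁) w₂ ≤ (2 : ℕ) ∧
      (rewire G (B.par w₁) {w₁} {w₃}).edist (B.par w₁) w₁ ≤ (3 : ℕ) := by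
  have hw₁ : w₁ ≠ B.par w₁ := (B.adj w₁ h.core₁.1).ne'
  have hw₂ : w₂ ≠ w₁ := by
    rintro rfl
    exact (B.adj w₂ h.core₂.1).ne h.par_eq
  have h₃ : (rewire G (B.par w₁) {w₁} {w₃}).edist (B.par w₁) w₃ ≤ (1 : ℕ) :=
    edist_rewire_le_one (Finset.mem_singleton_self w₃)
  have h₂ := edist_le_of_adj (rewire_adj_of_adj (X := {w₁}) (A := {w₃}) (a := B.par w₁) h.adj.symm
    (fun _ => by simpa using hw₂) (absurd · h.par_par_ne.symm)) h₃ le_rfl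
  have hadj : G.Adj w₂ w₁ := (h.par_eq ▸ B.adj w₂ h.core₂.1).symm
  exact ⟨h₂, edist_le_of_adj (rewire_adj_of_adj hadj (absurd · h.par_par_ne.symm)
    (absurd · hw₁)) h₂ le_rfl⟩

theorem rewire_adj_par (h : B.ThinPath w₁ w₂ w₃) (hzr : z ≠ r) (hz : ¬ B.Core z) :
    (rewire G (B.par w₁) {w₁} {w₃}).Adj (B.par z) z := by
  refine rewire_adj_of_adj (B.adj z hzr) (fun _ hzw => ?_) fun hzw hpar => ?_
  · exact hz (Finset.mem_singleton.1 hzw ▸ h.core₁)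
  · exact B.par_par_ne hzr (Finset.mem_singleton.1 hpar ▸ hzw.symm)

-- Swapping the edge to `w₁` for one to `w₃` is an improvement over the distances from `w₁`: paths
-- from `w₁` leave what hangs at `w₁` and `w₂` through `B.par w₁` or through `w₃`.
theorem edist_rewire_add_one_le (h : B.ThinPath w₁ w₂ w₃) (hz₁ : ¬ B.Hangs w₁ z)
    (hz₂ : ¬ B.Hangs w₂ z) :
    (rewire G (B.par w₁) {w₁} {w₃}).edist (B.par w₁) z + 1 ≤ G.dist w₁ z := by
  obtain ⟨B₁⟩ := exists_bfsTree B.connected w₁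
  refine B₁.edist_add_one_le_of_exit (H := {z | B.Hangs w₁ z ∨ B.Hangs w₂ z}) (Or.inl .refl)
    (fun p q hp hq hpq => ?_) (fun p q hp hq hpq => ?_) (not_or.2 ⟨hz₁, hz₂⟩)
  · have hne (v : V) (hv : v ∉ {z | B.Hangs w₁ z ∨ B.Hangs w₂ z}) : v ∉ ({w₁} : Finset V) :=
      fun hvw => hv (Finset.mem_singleton.1 hvw ▸ Or.inl .refl)
    exact rewire_adj_of_adj hpq (fun _ => hne q hq) fun _ => hne p hp
  · obtain ⟨-, rfl⟩ | ⟨rfl, rfl⟩ := h.eq_of_hangs_of_adj hp hq hpq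
    · simp
    · have hdist : G.dist w₁ p = 1 := h.par_eq ▸ B.dist_par_eq_one h.core₂.1
      simpa [hdist] using edist_rewire_le_one (Finset.mem_singleton_self q)

end ThinPath

end BFSTree

namespace CentralTree

variable {V : Type*} [Finite V] {α : ℝ≥0} {s : Profile V} {r : V} {T : CentralTree α s r}
  {w w₁ w₂ w₃ x y z : V} {d i : ℕ}

theorem edist_rewire_add_one_le_of_hangs (h : T.ThinPath w₁ w₂ w₃) (hz : T.Hangs w z) {c : ℕ}
    (hw : (rewire (graph s) (T.par w₁) {w₁} {w₃}).edist (T.par w₁) w ≤ c)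
    (hc : c + 1 ≤ (graph s).dist r w) (v : V) :
    (rewire (graph s) (T.par w₁) {w₁} {w₃}).edist (T.par w₁) z + 1 ≤ ecc (graph s) v := by
  have hwr : w ≠ r := by
    rintro rfl
    simp at hc
  have hzw := hz.edist_add_dist_le hwr (fun _ => h.rewire_adj_par) hw
  have hecc : (graph s).dist r z ≤ ecc (graph s) v :=
    (dist_le_ecc T.connected r z).trans (T.ecc_root_le v)
  have hne : (rewire (graph s) (T.par w₁) {w₁} {w₃}).edist (T.par w₁) z ≠ ⊤ :=
    ne_top_of_le_ne_top (ENat.natCast_ne_top _) (le_self_add.trans hzw)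
  lift (rewire (graph s) (T.par w₁) {w₁} {w₃}).edist (T.par w₁) z to ℕ using hne with e
  norm_cast at hzw ⊢
  omega

theorem ecc_par_lt_of_thinPath (h : T.ThinPath w₁ w₂ w₃) (hmem : w₁ ∈ (s (T.par w₁)).1)
    (hdist : 4 ≤ (graph s).dist r w₁) : ecc (graph s) (T.par w₁) < ecc (graph s) w₁ := by
  by_contra! hle
  have hdist₂ := T.dist_eq w₂ h.core₂.1
  rw [h.par_eq] at hdist₂
  have hdev (z : V) : (rewire (graph s) (T.par w₁) {w₁} {w₃}).edist (T.par w₁) z + 1 ≤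
      ecc (graph s) (T.par w₁) := by
    by_cases hz₁ : T.Hangs w₁ z
    · exact edist_rewire_add_one_le_of_hangs h hz₁ h.edist_rewire_le.2 hdist _
    · by_cases hz₂ : T.Hangs w₂ z
      · exact edist_rewire_add_one_le_of_hangs h hz₂ h.edist_rewire_le.1 (by omega) _
      · exact (h.edist_rewire_add_one_le hz₁ hz₂).trans
          (by exact_mod_cast (dist_le_ecc T.connected w₁ z).trans hle)
  obtain ⟨b, hb⟩ : ∃ b, ecc (graph s) (T.par w₁) = b + 1 := by
    refine Nat.exists_eq_add_one.2 ?_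
    exact_mod_cast le_add_self.trans (hdev r)
  have hcost := T.nash.mul_card_add_ecc_le_of_rewire T.connected
    (Finset.singleton_subset_iff.2 hmem) (A := {w₃}) (b := b) fun z => by
      have := hdev z
      rwa [hb, Nat.cast_add_one, ENat.add_le_add_iff_right ENat.one_ne_top] at this
  rw [hb, Finset.card_singleton, Finset.card_singleton] at hcost
  push_cast at hcost
  linarith

namespace BuysNonTree

theorem core_climb (h : T.BuysNonTree x y) (hi : i < α) : T.Core (T.climb x y (i + 1)) :=
  ⟨h.climb_ne_root hi, x, y, h.1, isAncestor_climb i⟩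

theorem below_climb (h : T.BuysNonTree x y) (hi : i < α) :
    T.Below (T.climb x y (i + 1)) (T.climb x y i) := by
  obtain _ | i := i
  · exact Or.inr h.1
  · exact Or.inl ⟨h.core_climb ((Nat.cast_le.2 i.le_succ).trans_lt hi), par_climb i⟩

theorem ecc_climb_le (h : T.BuysNonTree x y) (hα : (2 * d + 1 : ℕ) < α) (hi : i ≤ d + 1) :
    ecc (graph s) (T.climb x y (i + 1)) ≤ ecc (graph s) x + 1 := by
  obtain _ | j := i
  · exact Nat.le_succ _
  obtain ⟨B⟩ := exists_bfsTree T.connected x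
  refine T.nash.ecc_le_of_par_ne B (h.climb_mem hα hi) fun hpar => ?_
  have hx := h.lt_dist hα
  have hdist := (isAncestor_climb (T := T) (x := x) (y := y) j).dist_add_dist_le
  have htriangle := T.connected.dist_triangle (u := r) (v := T.climb x y (j + 1 + 1)) (w := x)
  have hdist' := B.dist_par (T.climb x y (j + 1))
  rw [hpar, SimpleGraph.dist_comm (u := x), SimpleGraph.dist_comm (u := x)] at hdist'
  rw [dist_climb] at hdist htriangle
  omega

theorem thinPath_climb (h : T.BuysNonTree x y) (hα : (2 * d + 1 : ℕ) < α) (hi : i + 1 ≤ d)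
    (h₁ : {z | T.Below (T.climb x y (i + 2)) z}.Subsingleton)
    (h₂ : {z | T.Below (T.climb x y (i + 1)) z}.Subsingleton) :
    T.ThinPath (T.climb x y (i + 2)) (T.climb x y (i + 1)) (T.climb x y i) where
  core₁ := h.core_climb ((Nat.cast_le.2 (by omega)).trans_lt hα)
  core₂ := h.core_climb ((Nat.cast_le.2 (by omega)).trans_lt hα)
  par_eq := par_climb i
  adj := Or.inr (h.climb_mem hα (by omega))
  eq_of_below₁ _ hz := h₁ hz (h.below_climb ((Nat.cast_le.2 (by omega)).trans_lt hα))
  eq_of_below₂ _ hz := h₂ hz (h.below_climb ((Nat.cast_le.2 (by omega)).trans_lt hα))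

theorem ecc_climb_lt (h : T.BuysNonTree x y) (hα : (2 * d + 1 : ℕ) < α) (hd : 2 ≤ d)
    (hi : i + 1 ≤ d) (h₁ : {z | T.Below (T.climb x y (i + 2)) z}.Subsingleton)
    (h₂ : {z | T.Below (T.climb x y (i + 1)) z}.Subsingleton) :
    ecc (graph s) (T.climb x y (i + 3)) < ecc (graph s) (T.climb x y (i + 2)) := by
  have hmem := h.climb_mem hα (i := i + 2) (by omega)
  have hx := h.lt_dist hα
  rw [← par_climb] at hmem ⊢
  refine ecc_par_lt_of_thinPath (h.thinPath_climb hα hi h₁ h₂) hmem ?_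
  rw [dist_climb]
  omega

-- Eccentricities on the climb lie between `ecc r` and `ecc r + 2`, so they cannot decrease three
-- times.
theorem exists_nontrivial_below (h : T.BuysNonTree x y) (hα : (2 * d + 1 : ℕ) < α)
    (hi : i + 3 ≤ d) : ∃ j < 4, {z | T.Below (T.climb x y (i + j + 1)) z}.Nontrivial := by
  by_contra! hthin
  have hlt (j : ℕ) (hj : j < 3) :
      ecc (graph s) (T.climb x y (i + j + 3)) < ecc (graph s) (T.climb x y (i + j + 2)) :=
    h.ecc_climb_lt hα (by omega) (by omega) (hthin (j + 1) (by omega)) (hthin j (by omega))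
  have h₀ : ecc (graph s) (T.climb x y (i + 3)) < ecc (graph s) (T.climb x y (i + 2)) :=
    hlt 0 (by omega)
  have h₁ : ecc (graph s) (T.climb x y (i + 4)) < ecc (graph s) (T.climb x y (i + 3)) :=
    hlt 1 (by omega)
  have h₂ : ecc (graph s) (T.climb x y (i + 5)) < ecc (graph s) (T.climb x y (i + 4)) :=
    hlt 2 (by omega)
  have hfirst : ecc (graph s) (T.climb x y (i + 2)) ≤ ecc (graph s) x + 1 :=
    h.ecc_climb_le hα (by omega)
  have hx := h.ecc_le
  have hlast := T.ecc_root_le (T.climb x y (i + 5))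
  omega

end BuysNonTree

end CentralTree

namespace BFSTree

variable {V : Type*} [Finite V] {G : SimpleGraph V} {r : V} {B : BFSTree G r} {z : V}

theorem ncard_core_add_ncard_branch_le (B : BFSTree G r) :
    {u | B.Core u}.ncard + {u | B.Core u ∧ {z | B.Below u z}.Nontrivial}.ncard ≤
      {q : V × V | B.Core q.1 ∧ B.Below q.1 q.2}.ncard := by
  have hfirst (u : V) (hu : B.Core u) : ∃ z, B.Below u z := hu.exists_below
  choose! f hf using hfirst
  have hsecond (u : V) (hu : {z | B.Below u z}.Nontrivial) : ∃ z, B.Below u z ∧ z ≠ f u :=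
    hu.exists_ne (f u)
  choose! g hg hgf using hsecond
  have hinj (f : V → V) : Function.Injective fun u => (u, f u) := fun _ _ h => congrArg Prod.fst h
  rw [← Set.ncard_image_of_injective _ (hinj f), ← Set.ncard_image_of_injective _ (hinj g),
    ← Set.ncard_union_eq]
  · refine Set.ncard_le_ncard ?_
    rintro _ (⟨u, hu, rfl⟩ | ⟨u, hu, rfl⟩)
    exacts [⟨hu, hf u hu⟩, ⟨hu.1, hg u hu.2⟩]
  · refine Set.disjoint_left.2 ?_
    rintro _ ⟨u, -, rfl⟩ ⟨u', hbranch, heq⟩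
    obtain ⟨rfl, h⟩ := Prod.mk.inj heq
    exact hgf _ hbranch.2 h

-- Within the tree every core vertex is below at most one vertex, its parent; a core child of the
-- root is below none, as the root is not in the core.
theorem Core.ncard_below_lt (h : B.Core z) :
    {q : V × V | B.Core q.1 ∧ B.Below q.1 q.2}.ncard <
      {u | B.Core u}.ncard + {q : V × V | B.NonTree q.1 q.2}.ncard := by
  obtain ⟨c, hc, hcr⟩ := h.exists_par_eq_root
  have hsub : {q : V × V | B.Core q.1 ∧ B.Below q.1 q.2} ⊆
      (fun z => (B.par z, z)) '' ({u | B.Core u} \ {c}) ∪ {q | B.NonTree q.1 q.2} := by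
    rintro ⟨u, z⟩ ⟨hu, ⟨hz, hzu⟩ | huz⟩
    · refine Or.inl ⟨z, ⟨hz, fun hzc => hu.1 ?_⟩, Prod.ext hzu rfl⟩
      exact hzu.symm.trans ((congrArg B.par hzc).trans hcr)
    · exact Or.inr huz
  refine (Set.ncard_le_ncard hsub).trans_lt ((Set.ncard_union_le _ _).trans_lt ?_)
  gcongr
  exact (Set.ncard_image_le).trans_lt (Set.ncard_sdiff_singleton_lt_of_mem hc)

end BFSTree

namespace CentralTree

variable {V : Type*} [Finite V] {α : ℝ≥0} {s : Profile V} {r : V} (T : CentralTree α s r)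

theorem ncard_nonTree_le : {q : V × V | T.NonTree q.1 q.2}.ncard ≤
    2 * {q : V × V | T.BuysNonTree q.1 q.2}.ncard := by
  have hsub : {q : V × V | T.NonTree q.1 q.2} ⊆
      {q | T.BuysNonTree q.1 q.2} ∪ Prod.swap '' {q | T.BuysNonTree q.1 q.2} := by
    rintro ⟨x, y⟩ h
    exact h.1.symm.imp (fun hy => ⟨h, hy⟩) fun hx => ⟨(y, x), ⟨h.symm, hx⟩, rfl⟩
  calc _ ≤ _ := Set.ncard_le_ncard hsub
    _ ≤ _ := Set.ncard_union_le _ _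
    _ ≤ _ := Nat.add_le_add_left Set.ncard_image_le _
    _ = _ := (two_mul _).symm

-- Each edge outside the tree gives a branching among the first four and another among the next
-- four vertices of its climb, and climbs of different edges are disjoint.
theorem two_mul_ncard_buysNonTree_le (hα : 15 < α) :
    2 * {q : V × V | T.BuysNonTree q.1 q.2}.ncard ≤
      {u | T.Core u ∧ {z | T.Below u z}.Nontrivial}.ncard := by
  have hα' : (2 * 7 + 1 : ℕ) < α := by exact_mod_cast hα
  have hbranch (q : V × V) (hq : T.BuysNonTree q.1 q.2) (i : ℕ) (hi : i ∈ ({0, 4} : Set ℕ)) :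
      ∃ j < 4, {z | T.Below (T.climb q.1 q.2 (i + j + 1)) z}.Nontrivial :=
    hq.exists_nontrivial_below hα' (by rcases hi with rfl | rfl <;> norm_num)
  choose! f hf₄ hf using hbranch
  have hlt (q : V × V) (hq : T.BuysNonTree q.1 q.2) (i : ℕ) (hi : i ∈ ({0, 4} : Set ℕ)) :
      i + f q i ≤ 7 := by
    have := hf₄ q hq i hi
    rcases hi with rfl | rfl <;> omega
  rw [mul_comm, ← Set.ncard_pair (by norm_num : (0 : ℕ) ≠ 4), ← Set.ncard_prod]
  refine Set.ncard_le_ncard_of_injOn (fun p => T.climb p.1.1 p.1.2 (p.2 + f p.1 p.2 + 1)) ?_ ?_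
  · rintro ⟨q, i⟩ ⟨hq, hi⟩
    exact ⟨hq.core_climb ((Nat.cast_le.2 ((hlt q hq i hi).trans (by norm_num))).trans_lt hα'),
      hf q hq i hi⟩
  · rintro ⟨⟨x, y⟩, i⟩ ⟨hq, hi⟩ ⟨⟨x', y'⟩, i'⟩ ⟨hq', hi'⟩ heq
    obtain ⟨rfl, rfl, hii'⟩ := hq.climb_inj hq' hα' (hlt _ hq i hi) (hlt _ hq' i' hi') heq
    have hfi : f (x, y) i < 4 := hf₄ _ hq i hi
    have hfi' : f (x, y) i' < 4 := hf₄ _ hq i' hi'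
    change i + f (x, y) i = i' + f (x, y) i' at hii'
    rcases hi with rfl | rfl <;> rcases hi' with rfl | rfl <;> first | rfl | omega

end CentralTree

theorem IsNash.isTree {V : Type*} [Finite V] [Nonempty V] {α : ℝ≥0} {s : Profile V}
    (hs : IsNash α s) (hα : 15 < α) : (graph s).IsTree := by
  obtain ⟨r, ⟨T⟩⟩ := hs.exists_centralTree
  refine T.isTree_iff.2 fun x y hxy => ?_
  obtain ⟨z, hz⟩ : ∃ z, T.Core z := by
    by_cases hx : x = r
    · exact ⟨y, hxy.symm.core (hx ▸ hxy.1.ne')⟩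
    · exact ⟨x, hxy.core hx⟩
  have := hz.ncard_below_lt
  have := T.ncard_core_add_ncard_branch_le
  have := T.ncard_nonTree_le
  have := T.two_mul_ncard_buysNonTree_le hα
  omega

section SocialCost

variable {V : Type*} [Fintype V] {α : ℝ≥0} {s : Profile V} {r : V} {m : ℕ}

/-- The edge that an agent pays for, for a pair of an agent and a member of its strategy. -/
def paidEdge (s : Profile V) (q : Σ v, (s v).1) : (graph s).edgeSet := ⟨s(q.1, q.2.1), Or.inr q.2.2⟩

omit [Fintype V] in
theorem paidEdge_surjective (s : Profile V) : Function.Surjective (paidEdge s) := by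
  rintro ⟨e, he⟩
  induction e with | _ x y
  rcases he with h | h
  exacts [⟨⟨y, x, h⟩, Subtype.ext Sym2.eq_swap⟩, ⟨⟨x, y, h⟩, rfl⟩]

omit [Fintype V] in
theorem IsNash.paidEdge_injective [Finite V] (hs : IsNash α s) (hα : 0 < α) :
    Function.Injective (paidEdge s) := by
  rintro ⟨v, w, hw⟩ ⟨v', w', hw'⟩ heq
  rcases Sym2.eq_iff.1 (congrArg Subtype.val heq) with ⟨rfl, h⟩ | ⟨rfl, h⟩
  · obtain rfl : w = w' := h
    rfl
  · obtain rfl : w = v' := h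
    exact absurd hw' (hs.notMem_of_mem hα hw)

theorem card_sigma_eq_sum_card (s : Profile V) :
    Nat.card (Σ v, (s v).1) = ∑ v, (s v).1.card := by
  simp

theorem le_sum_card (hG : (graph s).Connected) (hm : Fintype.card V = m + 1) :
    m ≤ ∑ v, (s v).1.card := by
  have hedges := hG.card_vert_le_card_edgeSet_add_one
  have hpaid := Nat.card_le_card_of_surjective _ (paidEdge_surjective s)
  rw [card_sigma_eq_sum_card] at hpaid
  rw [Nat.card_eq_fintype_card, hm] at hedges
  omega

theorem IsNash.sum_card_le (hs : IsNash α s) (hα : 0 < α) (hG : (graph s).IsTree)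
    (hm : Fintype.card V = m + 1) : ∑ v, (s v).1.card ≤ m := by
  have hedges := (SimpleGraph.isTree_iff_connected_and_card.1 hG).2
  have hpaid := Nat.card_le_card_of_injective _ (hs.paidEdge_injective hα)
  rw [card_sigma_eq_sum_card] at hpaid
  rw [Nat.card_eq_fintype_card (α := V), hm] at hedges
  omega

theorem le_socialCost [Nontrivial V] (α : ℝ≥0) (s : Profile V) (hm : Fintype.card V = m + 1) :
    ((α * m + (m + 1) : ℝ≥0) : ℝ≥0∞) ≤ socialCost α s := by
  by_cases hG : (graph s).Connected
  · have hecc : m + 1 ≤ ∑ v, ecc (graph s) v := by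
      simpa [hm] using Finset.card_nsmul_le_sum Finset.univ (ecc (graph s)) 1
        fun v _ => one_le_ecc hG v
    have hcost : α * m + (m + 1) ≤ ∑ v, (α * (s v).1.card + ecc (graph s) v) := by
      rw [Finset.sum_add_distrib, ← Finset.mul_sum]
      gcongr
      · exact_mod_cast le_sum_card hG hm
      · exact_mod_cast hecc
    rw [socialCost, Finset.sum_congr rfl fun v _ => agentCost_of_connected hG v]
    exact_mod_cast hcost
  · obtain ⟨v⟩ : Nonempty V := inferInstance
    calc _ ≤ agentCost α s v := agentCost_eq_top (α := α) hG ▸ le_top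
      _ ≤ socialCost α s :=
        Finset.single_le_sum (f := agentCost α s) (fun _ _ => zero_le) (Finset.mem_univ v)

omit [Fintype V] in
theorem IsNash.ecc_le_add_two [Finite V] (hs : IsNash α s) (hG : (graph s).IsTree)
    (hr : ∀ v, ecc (graph s) r ≤ ecc (graph s) v) : (ecc (graph s) r : ℝ) ≤ α + 2 := by
  obtain ⟨B⟩ := exists_bfsTree hG.connected r
  obtain ⟨f, hf⟩ := B.exists_two_mul_ecc_le hG hr
  have hf' : 2 * (ecc (graph s) r : ℝ) ≤ ecc (graph s) f + 1 := by exact_mod_cast hf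
  have := hs.ecc_le_add r f
  linarith

-- The central vertex and one of its neighbours save `α` each compared with the bound `2 * α + 3`
-- for the other vertices.
theorem IsNash.sum_ecc_le [Nontrivial V] (hs : IsNash α s) (hG : (graph s).IsTree)
    (hm : Fintype.card V = m + 1) :
    ∑ v, (ecc (graph s) v : ℝ) ≤ 2 * α * m + 3 * m + 2 := by
  classical
  obtain ⟨r, hr⟩ := exists_forall_ecc_le hG.connected
  obtain ⟨c, hrc⟩ := hG.connected.preconnected.exists_adj_of_nontrivial r
  have hecc_r := hs.ecc_le_add_two hG hr
  have hecc_c : (ecc (graph s) c : ℝ) ≤ ecc (graph s) r + 1 := by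
    exact_mod_cast SimpleGraph.dist_eq_one_iff_adj.2 hrc ▸ ecc_le_ecc_add_dist hG.connected r c
  have hsub : ({r, c} : Finset V) ⊆ Finset.univ := Finset.subset_univ _
  have hcard : ((Finset.univ \ {r, c} : Finset V).card : ℝ) + 2 = m + 1 := by
    have := Finset.card_sdiff_add_card_eq_card hsub
    rw [Finset.card_pair hrc.ne, Finset.card_univ, hm] at this
    exact_mod_cast this
  have hrest : ∑ v ∈ Finset.univ \ {r, c}, (ecc (graph s) v : ℝ) ≤
      (Finset.univ \ {r, c} : Finset V).card • (2 * (α : ℝ) + 3) :=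
    Finset.sum_le_card_nsmul _ _ _ fun v _ => by
      have := hs.ecc_le_add r v
      linarith
  rw [nsmul_eq_mul, eq_sub_of_add_eq hcard] at hrest
  rw [← Finset.sum_sdiff hsub, Finset.sum_pair hrc.ne]
  linarith

theorem IsNash.socialCost_le [Nontrivial V] (hs : IsNash α s) (hα : 0 < α)
    (hG : (graph s).IsTree) (hm : Fintype.card V = m + 1) :
    socialCost α s ≤ (3 * α * m + 3 * m + 2 : ℝ≥0) := by
  have hecc := hs.sum_ecc_le hG hm
  have hcard : ∑ v, ((s v).1.card : ℝ) ≤ m := by exact_mod_cast hs.sum_card_le hα hG hm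
  have hcost : ∑ v, (α * (s v).1.card + ecc (graph s) v) ≤ 3 * α * m + 3 * m + 2 := by
    rw [← NNReal.coe_le_coe]
    push_cast
    rw [Finset.sum_add_distrib, ← Finset.mul_sum]
    have := mul_le_mul_of_nonneg_left hcard (NNReal.coe_nonneg α)
    linarith
  rw [socialCost, Finset.sum_congr rfl fun v _ => agentCost_of_connected hG.connected v]
  exact_mod_cast hcost

end SocialCost

section Star

variable {V : Type*} {α : ℝ≥0} {s : Profile V} {c v z : V} {k : ℕ}

theorem le_agentCost (h : (k : ℕ∞) ≤ (graph s).edist v z) :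
    ((α * (s v).1.card + k : ℝ≥0) : ℝ≥0∞) ≤ agentCost α s v := by
  rw [agentCost]
  push_cast
  gcongr
  exact (ENat.toENNReal_coe k).ge.trans
    (ENat.toENNReal_le.2 (h.trans (le_iSup (fun u => (graph s).edist v u) z)))

open Classical in
/-- The star in which every leaf pays for its edge to the centre `c`. -/
noncomputable def star (c : V) : Profile V := fun v =>
  ⟨if v = c then ∅ else {c}, by
    split_ifs with h
    exacts [Finset.notMem_empty v, Finset.notMem_singleton.2 h]⟩

theorem coe_star_self (c : V) : (star c c).1 = ∅ := if_pos rfl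

theorem coe_star_of_ne (h : v ≠ c) : (star c v).1 = {c} := if_neg h

theorem edist_star_le (c z : V) : (graph (star c)).edist c z ≤ (1 : ℕ) := by
  rw [Nat.cast_one, SimpleGraph.edist_le_one_iff_adj_or_eq]
  by_cases h : z = c
  · exact Or.inr h.symm
  · exact Or.inl (Or.inl (by simp [coe_star_of_ne h]))

theorem agentCost_star_self_le (c : V) : agentCost α (star c) c ≤ 1 := by
  simpa [coe_star_self] using agentCost_le_of_edist_le (α := α) (edist_star_le c)

theorem agentCost_star_le (c v : V) : agentCost α (star c) v ≤ (α + 2 : ℝ≥0) := by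
  refine (agentCost_le_of_edist_le fun z => edist_le_of_edist_le (p := c)
    (SimpleGraph.edist_comm ▸ edist_star_le c v) (edist_star_le c z)).trans ?_
  have hcost : α * ((star c v).1.card : ℝ≥0) + (1 + 1 : ℕ) ≤ α + 2 := by
    by_cases h : v = c
    · rw [h, coe_star_self]
      simp [one_add_one_eq_two]
    · simp [coe_star_of_ne h, one_add_one_eq_two]
  exact_mod_cast hcost

theorem mem_of_adj_of_eq_star (hv : v ≠ c) (hs : ∀ u, u ≠ v → s u = star c u)
    (h : (graph s).Adj v z) : z ∈ (s v).1 := by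
  refine h.resolve_left fun hz => ?_
  rw [hs z h.ne'] at hz
  by_cases hzc : z = c
  · rw [hzc, coe_star_self] at hz
    exact Finset.notMem_empty v hz
  · exact hv (Finset.mem_singleton.1 (coe_star_of_ne hzc ▸ hz))

theorem two_le_card_of_ne_star (hv : v ≠ c) (hs : ∀ u, u ≠ v → s u = star c u)
    (hc : c ∈ (s v).1) (hne : s ≠ star c) : 2 ≤ (s v).1.card := by
  by_contra! hlt
  refine hne (funext fun u => ?_)
  by_cases hu : u = v
  · rw [hu]
    refine Subtype.ext (Eq.trans ?_ (coe_star_of_ne hv).symm)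
    exact (Finset.eq_of_subset_of_card_le (Finset.singleton_subset_iff.2 hc)
      (Nat.le_of_lt_succ hlt)).symm
  · exact hs u hu

theorem add_two_le_agentCost (hα : 2 ≤ α) (hv : v ≠ c) (hs : ∀ u, u ≠ v → s u = star c u)
    (hne : s ≠ star c) : ((α + 2 : ℝ≥0) : ℝ≥0∞) ≤ agentCost α s v := by
  by_cases hc : c ∈ (s v).1
  · have hcard := two_le_card_of_ne_star hv hs hc hne
    refine le_trans ?_ (le_agentCost (k := 0) (z := v) (by simp))
    have hcard' : (2 : ℝ≥0) ≤ (s v).1.card := by exact_mod_cast hcard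
    have : α + 2 ≤ α * (s v).1.card + (0 : ℕ) := by
      calc α + 2 ≤ α * 2 := by rw [mul_two]; gcongr
        _ ≤ α * (s v).1.card + (0 : ℕ) := by rw [Nat.cast_zero, add_zero]; gcongr
    exact_mod_cast this
  · by_cases hG : (graph s).Connected
    · have := nontrivial_of_ne v c hv
      obtain ⟨z, hz⟩ := hG.preconnected.exists_adj_of_nontrivial v
      have hcard : (1 : ℝ≥0) ≤ (s v).1.card := by
        exact_mod_cast Finset.card_pos.2 ⟨z, mem_of_adj_of_eq_star hv hs hz⟩
      have hdist : (2 : ℕ) ≤ (graph s).edist v c := by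
        rw [← (hG v c).coe_dist_eq_edist, Nat.cast_le]
        have hpos := hG.pos_dist_of_ne hv
        have hone : (graph s).dist v c ≠ 1 := fun h =>
          hc (mem_of_adj_of_eq_star hv hs (SimpleGraph.dist_eq_one_iff_adj.1 h))
        omega
      refine le_trans ?_ (le_agentCost hdist)
      gcongr
      · exact le_mul_of_one_le_right' hcard
      · norm_num
    · exact agentCost_eq_top (α := α) hG ▸ le_top

theorem isNash_star [Nontrivial V] (hα : 2 ≤ α) (c : V) : IsNash α (star c) := by
  intro v s hs
  by_cases hv : v = c
  · subst hv
    obtain ⟨z, hz⟩ := exists_ne v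
    refine (agentCost_star_self_le v).trans (le_trans ?_ (le_agentCost (k := 1) (z := z) ?_))
    · simp
    · rw [Nat.cast_one, Order.one_le_iff_pos]
      exact SimpleGraph.edist_pos_of_ne hz.symm
  · by_cases hne : s = star c
    · rw [hne]
    · exact (agentCost_star_le c v).trans (add_two_le_agentCost hα hv hs hne)

end Star

section PriceOfAnarchy

variable {V : Type*} [Fintype V] {α : ℝ≥0} {m : ℕ}

theorem le_optimalCost [Nontrivial V] (α : ℝ≥0) (hm : Fintype.card V = m + 1) :
    ((α * m + (m + 1) : ℝ≥0) : ℝ≥0∞) ≤ optimalCost V α :=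
  le_iInf fun s => le_socialCost α s hm

theorem optimalCost_lt_top (V : Type*) [Fintype V] [Nonempty V] (α : ℝ≥0) :
    optimalCost V α < ⊤ := by
  obtain ⟨c⟩ := ‹Nonempty V›
  exact (iInf_le _ (star c)).trans_lt
    (ENNReal.sum_lt_top.2 fun v _ => (agentCost_star_le c v).trans_lt ENNReal.coe_lt_top)

theorem worstNashCost_le [Nontrivial V] (hα : 15 < α) (hm : Fintype.card V = m + 1) :
    worstNashCost V α ≤ (3 * α * m + 3 * m + 2 : ℝ≥0) :=
  iSup₂_le fun _ hs => IsNash.socialCost_le hs (pos_of_gt hα) (IsNash.isTree hs hα) hm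

end PriceOfAnarchy

end NetworkCreation

theorem corollary1_general (V : Type*) [Fintype V] [Nontrivial V] (α : ℝ≥0) (hα : 15 < α) :
    (∃ s : NetworkCreation.Profile V, NetworkCreation.IsNash α s) ∧
      0 < NetworkCreation.optimalCost V α ∧
      NetworkCreation.optimalCost V α < ⊤ ∧
      NetworkCreation.priceOfAnarchy V α < 3 := by
  obtain ⟨c⟩ : Nonempty V := inferInstance
  obtain ⟨m, hm⟩ := Nat.exists_eq_succ_of_ne_zero (Fintype.card_ne_zero (α := V))
  have hopt := NetworkCreation.le_optimalCost α hm
  have hgap : 3 * α * m + 3 * m + 2 < 3 * (α * m + (m + 1)) := by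
    rw [← NNReal.coe_lt_coe]
    push_cast
    linarith
  refine ⟨⟨_, NetworkCreation.isNash_star (le_trans (by norm_num) hα.le) c⟩,
    (ENNReal.coe_pos.2 (by positivity)).trans_le hopt,
    NetworkCreation.optimalCost_lt_top V α, ENNReal.div_lt_of_lt_mul ?_⟩
  calc NetworkCreation.worstNashCost V α
    _ ≤ (3 * α * m + 3 * m + 2 : ℝ≥0) := NetworkCreation.worstNashCost_le hα hm
    _ < (3 * (α * m + (m + 1)) : ℝ≥0) := ENNReal.coe_lt_coe.2 hgap
    _ = 3 * (α * m + (m + 1) : ℝ≥0) := ENNReal.coe_mul _ _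
    _ ≤ 3 * NetworkCreation.optimalCost V α := by gcongr

/-- For at least two agents and `α > 19`, the price of anarchy is a well-defined ratio (there is a
Nash equilibrium, and the optimal social cost is positive and finite) and it is less than `3`. -/
theorem corollary1 (n : ℕ) (hn : 2 ≤ n) (α : ℝ≥0) (hα : 19 < α) :
    (∃ s : NetworkCreation.Profile (Fin n), NetworkCreation.IsNash α s) ∧
      0 < NetworkCreation.optimalCost (Fin n) α ∧
      NetworkCreation.optimalCost (Fin n) α < ⊤ ∧
      NetworkCreation.priceOfAnarchy (Fin n) α < 3 := by
  have : Nontrivial (Fin n) := Fin.nontrivial_iff_two_le.2 hn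
  exact corollary1_general (Fin n) α (lt_trans (by norm_num) hα)
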